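/- Consider the class of equations $$u_t+F(t)u^2u_x+u_{xxx}=L(t),\qquad F\neq 0,$$ where the arbitrary elements $F$ and $L$ are smooth real functions on a nonempty open interval and $F$ vanishes nowhere. A point transformation is a smooth map $(t,x,u)\mapsto(\tilde t,\tilde x,\tilde u)$ with nonvanishing Jacobian on a nonempty connected open subset of $\mathbb R^3$; it is admissible for two equations of the class if its domain lies over the interval of the first one, it takes values over the interval of the second one, and its prolongation to 3-jets takes jets satisfying the first equation, and only these, to jets satisfying the second one. A usual equivalence transformation of the class consists of a point transformation $(t,x,u)\mapsto(\tilde t,\tilde x,\tilde u)$, not involving $F$ and $L$, together with functions $\tilde F,\tilde L$ of $(t,x,u,F,L)$, defined for all $F\ne0$ and $L$, such that the joint map $(t,x,u,F,L)\mapsto(\tilde t,\tilde x,\tilde u,\tilde F,\tilde L)$ is smooth with nonvanishing Jacobian, and maps every equation of the class to an equation of the class with the arbitrary elements $\tilde F(\tilde t)$, $\tilde L(\tilde t)$. These transformations form the usual equivalence (pseudo)group $G^\sim_2$. Theorem. The class is normalized in the usual sense: every admissible transformation between two of its equations is induced by an element of $G^\sim_2$, that is, it coincides on its domain with the $(t,x,u)$-components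 of such an element, whose $(F,L)$-components take the arbitrary elements of the first equation to those of the second one there. The group $G^\sim_2$ consists exactly of the transformations (on arbitrary nonempty connected open domains of $(t,x,u)$) $$\tilde t=\delta_1^{3}t+\delta_0,\quad \tilde x=\delta_1x+\delta_3,\quad \tilde u=\delta_2u,\quad \tilde F(\tilde t)=\frac{F(t)}{\delta_1^{2}\delta_2^{2}},\quad \tilde L(\tilde t)=\frac{\delta_2}{\delta_1^{3}}L(t),$$ where $\delta_0,\delta_1,\delta_2,\delta_3$ are arbitrary real constants with $\delta_1\delta_2\neq0$. -/

import Mathlib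

open scoped ContDiff Topology

namespace ForcedMKdV

/-- An equation `u_t + F(t) u² u_x + u_xxx = L(t)` of the class: the arbitrary elements `F` and `L`
are smooth real functions on a nonempty open interval, and `F` vanishes nowhere on it.  The values
of `F` and `L` outside the interval are irrelevant. -/
structure Equation where
  /-- the interval on which the coefficients are defined -/
  interval : Set ℝ
  isOpen_interval : IsOpen interval
  isConnected_interval : IsConnected interval
  F : ℝ → ℝ
  L : ℝ → ℝ
  smooth_F : ContDiffOn ℝ ∞ F interval
  smooth_L : ContDiffOn ℝ ∞ L interval
  F_ne_zero : ∀ t ∈ interval, F t ≠ 0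

/-- The function `u` of `(t, x)` satisfies the equation at the single point `(t, x)`, i.e. the
3-jet of `u` at `(t, x)` lies in the subset of the jet space defined by the equation. -/
def Equation.HoldsAt (E : Equation) (u : ℝ × ℝ → ℝ) (t x : ℝ) : Prop :=
  deriv (fun s => u (s, x)) t + E.F t * u (t, x) ^ 2 * deriv (fun y => u (t, y)) x
    + iteratedDeriv 3 (fun y => u (t, y)) x = E.L t

/-- `φ` is a (locally defined) nondegenerate point transformation of the space of the variables
`(t, x, u)` with domain `Ω`: `Ω` is a nonempty connected open set, and `φ` is smooth on `Ω` with
nonvanishing Jacobian determinant.  The components of `φ (t, x, u)` are `(t̃, x̃, ũ)`. -/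
structure IsPointTransformation (φ : ℝ × ℝ × ℝ → ℝ × ℝ × ℝ) (Ω : Set (ℝ × ℝ × ℝ)) : Prop where
  isOpen : IsOpen Ω
  isConnected : IsConnected Ω
  smooth : ContDiffOn ℝ ∞ φ Ω
  nondegenerate : ∀ p ∈ Ω, (fderiv ℝ φ p).det ≠ 0

/-- Near the point of the graph of `u` over `(t, x)`, the map `φ` carries the graph of `u` into the
graph of `v`: `ũ = v (t̃, x̃)` holds for `(t̃, x̃, ũ) = φ (s, y, u (s, y))` and `(s, y)` near
`(t, x)`.  (When `φ` is nondegenerate, `(s, y) ↦ (t̃, x̃)` is then a local diffeomorphism at `(t, x)`,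
so the germ of `v` at the image of `(t, x)` is determined by the germ of `u`, and the 3-jet of `v`
there is the image of the 3-jet of `u` under the prolongation of `φ`.) -/
def CarriesGraph (φ : ℝ × ℝ × ℝ → ℝ × ℝ × ℝ) (u v : ℝ × ℝ → ℝ) (t x : ℝ) : Prop :=
  ∀ᶠ q in 𝓝 (t, x),
    v ((φ (q.1, q.2, u q)).1, (φ (q.1, q.2, u q)).2.1) = (φ (q.1, q.2, u q)).2.2

/-- The map `φ`, restricted to the points `(t, x, u)` of `Ω`, transforms the equation `E` to the
equation `E'`: new times lie in the interval of `E'`, and under the prolongation of `φ` to the 3-jets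
of functions, a jet over a point of `Ω` satisfies `E` if and only if its image satisfies `E'`.
Jets are represented by germs of smooth functions; these need not be solutions. -/
def Transforms (φ : ℝ × ℝ × ℝ → ℝ × ℝ × ℝ) (Ω : Set (ℝ × ℝ × ℝ)) (E E' : Equation) : Prop :=
  (∀ p ∈ Ω, (φ p).1 ∈ E'.interval) ∧
  ∀ (u v : ℝ × ℝ → ℝ) (t x t' x' u' : ℝ),
    (t, x, u (t, x)) ∈ Ω → φ (t, x, u (t, x)) = (t', x', u') →
    ContDiffAt ℝ ∞ u (t, x) → ContDiffAt ℝ ∞ v (t', x') → CarriesGraph φ u v t x →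
    (E.HoldsAt u t x ↔ E'.HoldsAt v t' x')

/-- `(E, E', φ)`, with `φ` defined on `Ω`, is an admissible transformation of the class: `φ` is a
nondegenerate point transformation that links the equation `E` to the equation `E'`. -/
structure IsAdmissible (E E' : Equation) (φ : ℝ × ℝ × ℝ → ℝ × ℝ × ℝ)
    (Ω : Set (ℝ × ℝ × ℝ)) : Prop where
  pointTransformation : IsPointTransformation φ Ω
  time_mem : ∀ p ∈ Ω, p.1 ∈ E.interval
  transforms : Transforms φ Ω E E'

/-- The values `(F, L)` that the arbitrary elements may take. -/
def arbitraryValues : Set (ℝ × ℝ) := {a | a.1 ≠ 0}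

/-- Data of a transformation of variables and arbitrary elements in which the transformation of the
variables does not involve the arbitrary elements:
`(t̃, x̃, ũ) = vars (t, x, u)` and `(F̃, L̃) = elts (t, x, u) (F, L)`, for `(t, x, u) ∈ domain`. -/
structure ExtendedTransformation where
  domain : Set (ℝ × ℝ × ℝ)
  vars : ℝ × ℝ × ℝ → ℝ × ℝ × ℝ
  elts : ℝ × ℝ × ℝ → ℝ × ℝ → ℝ × ℝ
  isOpen_domain : IsOpen domain
  isConnected_domain : IsConnected domain

/-- The underlying map `(t, x, u, F, L) ↦ (t̃, x̃, ũ, F̃, L̃)`. -/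
def ExtendedTransformation.toMap (T : ExtendedTransformation) :
    (ℝ × ℝ × ℝ) × (ℝ × ℝ) → (ℝ × ℝ × ℝ) × (ℝ × ℝ) :=
  fun z => (T.vars z.1, T.elts z.1 z.2)

/-- `T` takes the arbitrary elements of `E` to those of `E'`, over the points of `Ω`:
`(F̃, L̃)` at the time `t̃` is the `(F, L)`-component of `T` at `(t, x, u, F(t), L(t))`. -/
def ExtendedTransformation.MapsElements (T : ExtendedTransformation) (Ω : Set (ℝ × ℝ × ℝ))
    (E E' : Equation) : Prop :=
  ∀ p ∈ Ω, (E'.F (T.vars p).1, E'.L (T.vars p).1) = T.elts p (E.F p.1, E.L p.1)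

/-- `T` is a usual equivalence transformation of the class: it is a nondegenerate point
transformation of the variables and the arbitrary elements, and it maps every equation `E` of the
class to an equation `E'` of the class, whose arbitrary elements are the images of those of `E`. -/
structure ExtendedTransformation.IsUsualEquivalence (T : ExtendedTransformation) : Prop where
  pointTransformation : IsPointTransformation T.vars T.domain
  smooth : ContDiffOn ℝ ∞ T.toMap (T.domain ×ˢ arbitraryValues)
  nondegenerate : ∀ z ∈ T.domain ×ˢ arbitraryValues, (fderiv ℝ T.toMap z).det ≠ 0
  maps_class : ∀ E : Equation, ∃ E' : Equation,
    Transforms T.vars {p ∈ T.domain | p.1 ∈ E.interval} E E' ∧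
      T.MapsElements {p ∈ T.domain | p.1 ∈ E.interval} E E'

/-- The usual equivalence (pseudo)group of the class, as the set of its elements. -/
def usualEquivalenceGroup : Set ExtendedTransformation := {T | T.IsUsualEquivalence}

/-- The class is normalized in the usual sense: every admissible transformation is induced by an
element of the usual equivalence group. -/
def IsNormalizedInUsualSense : Prop :=
  ∀ (E E' : Equation) (φ : ℝ × ℝ × ℝ → ℝ × ℝ × ℝ) (Ω : Set (ℝ × ℝ × ℝ)),
    IsAdmissible E E' φ Ω →
    ∃ T ∈ usualEquivalenceGroup, Ω ⊆ T.domain ∧ Set.EqOn φ T.vars Ω ∧ T.MapsElements Ω E E'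

end ForcedMKdV

namespace ForcedMKdV

/-- The derivative of `g` at `p` in the direction `e`. -/
noncomputable def dirDeriv (e : ℝ × ℝ × ℝ) (g : ℝ × ℝ × ℝ → ℝ) (p : ℝ × ℝ × ℝ) : ℝ :=
  fderiv ℝ g p e

/-- The partial derivative with respect to `t`. -/
noncomputable abbrev pdt : (ℝ × ℝ × ℝ → ℝ) → ℝ × ℝ × ℝ → ℝ := dirDeriv (1, 0, 0)

/-- The partial derivative with respect to `x`. -/
noncomputable abbrev pdx : (ℝ × ℝ × ℝ → ℝ) → ℝ × ℝ × ℝ → ℝ := dirDeriv (0, 1, 0)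

/-- The partial derivative with respect to `u`. -/
noncomputable abbrev pdu : (ℝ × ℝ × ℝ → ℝ) → ℝ × ℝ × ℝ → ℝ := dirDeriv (0, 0, 1)

theorem contDiffAt_dirDeriv {e : ℝ × ℝ × ℝ} {g : ℝ × ℝ × ℝ → ℝ} {p : ℝ × ℝ × ℝ}
    (hg : ContDiffAt ℝ ∞ g p) : ContDiffAt ℝ ∞ (dirDeriv e g) p :=
  (hg.fderiv_right (m := ∞) (by simp)).clm_apply contDiffAt_const

theorem differentiableAt_of_smooth {E F : Type*} [NormedAddCommGroup E] [NormedSpace ℝ E]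
    [NormedAddCommGroup F] [NormedSpace ℝ F] {g : E → F} {p : E} (hg : ContDiffAt ℝ ∞ g p) :
    DifferentiableAt ℝ g p :=
  hg.differentiableAt (by simp)

theorem eventually_differentiableAt {E F : Type*} [NormedAddCommGroup E] [NormedSpace ℝ E]
    [NormedAddCommGroup F] [NormedSpace ℝ F] {g : E → F} {p : E} (hg : ContDiffAt ℝ ∞ g p) :
    ∀ᶠ q in 𝓝 p, DifferentiableAt ℝ g q :=
  ((hg.of_le (m := 1) (by exact_mod_cast le_top)).eventually (by simp)).mono
    fun _ h => h.differentiableAt (by simp)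

theorem contDiffAt_deriv {f : ℝ → ℝ} {x : ℝ} (hf : ContDiffAt ℝ ∞ f x) :
    ContDiffAt ℝ ∞ (deriv f) x :=
  (hf.fderiv_right (m := ∞) (by simp)).clm_apply contDiffAt_const

theorem dirDeriv_comm {g : ℝ × ℝ × ℝ → ℝ} {p : ℝ × ℝ × ℝ} (hg : ContDiffAt ℝ ∞ g p)
    (e e' : ℝ × ℝ × ℝ) : dirDeriv e (dirDeriv e' g) p = dirDeriv e' (dirDeriv e g) p := by
  have hd : DifferentiableAt ℝ (fderiv ℝ g) p :=
    differentiableAt_of_smooth (hg.fderiv_right (m := ∞) (by simp))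
  have key : ∀ a b : ℝ × ℝ × ℝ, dirDeriv a (dirDeriv b g) p = fderiv ℝ (fderiv ℝ g) p a b := by
    intro a b
    have := (hd.hasFDerivAt.clm_apply (hasFDerivAt_const b p)).fderiv
    simp only [dirDeriv]
    change fderiv ℝ (fun q => fderiv ℝ g q b) p a = _
    rw [this]
    simp
  rw [key, key]
  exact (hg.isSymmSndFDerivAt (by simpa using (mod_cast le_top : ((2 : ℕ∞) : WithTop ℕ∞) ≤ ∞))) e e'

theorem dirDeriv_congr {e : ℝ × ℝ × ℝ} {g h : ℝ × ℝ × ℝ → ℝ} {p : ℝ × ℝ × ℝ} (hgh : g =ᶠ[𝓝 p] h) :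
    dirDeriv e g p = dirDeriv e h p := by
  simp only [dirDeriv, hgh.fderiv_eq]

theorem fderiv_apply_eq_partials (g : ℝ × ℝ × ℝ → ℝ) (p : ℝ × ℝ × ℝ) (a b c : ℝ) :
    fderiv ℝ g p (a, b, c) = pdt g p * a + pdx g p * b + pdu g p * c := by
  have : ((a, b, c) : ℝ × ℝ × ℝ) = a • (1, 0, 0) + b • (0, 1, 0) + c • (0, 0, 1) := by
    simp
  rw [this, map_add, map_add, map_smul, map_smul, map_smul]
  simp only [dirDeriv, smul_eq_mul]
  ring

/-- The first total `x`-derivative of `g`, on a jet with `u_x = a`. -/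
noncomputable def total₁ (g : ℝ × ℝ × ℝ → ℝ) (p : ℝ × ℝ × ℝ) (a : ℝ) : ℝ :=
  pdx g p + pdu g p * a

/-- The second total `x`-derivative of `g`, on a jet with `u_x = a`, `u_xx = b`. -/
noncomputable def total₂ (g : ℝ × ℝ × ℝ → ℝ) (p : ℝ × ℝ × ℝ) (a b : ℝ) : ℝ :=
  total₁ (pdx g) p a + total₁ (pdu g) p a * a + pdu g p * b

/-- The third total `x`-derivative of `g`, on a jet with `u_x = a`, `u_xx = b`, `u_xxx = c`. -/
noncomputable def total₃ (g : ℝ × ℝ × ℝ → ℝ) (p : ℝ × ℝ × ℝ) (a b c : ℝ) : ℝ :=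
  total₂ (pdx g) p a b + total₂ (pdu g) p a b * a + 2 * total₁ (pdu g) p a * b + pdu g p * c

section Curve

variable {g : ℝ × ℝ × ℝ → ℝ} {f : ℝ → ℝ} {t x : ℝ}

theorem hasDerivAt_curve (hg : DifferentiableAt ℝ g (t, x, f x)) (hf : DifferentiableAt ℝ f x) :
    HasDerivAt (fun y => g (t, y, f y)) (total₁ g (t, x, f x) (deriv f x)) x := by
  have hc : HasDerivAt (fun y => ((t, y, f y) : ℝ × ℝ × ℝ)) (0, 1, deriv f x) x :=
    (hasDerivAt_const x t).prodMk ((hasDerivAt_id x).prodMk hf.hasDerivAt)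
  have := hg.hasFDerivAt.comp_hasDerivAt x hc
  rw [fderiv_apply_eq_partials] at this
  refine this.congr_deriv ?_
  rw [total₁]
  ring

theorem contDiffAt_curve (hg : ContDiffAt ℝ ∞ g (t, x, f x)) (hf : ContDiffAt ℝ ∞ f x) :
    ContDiffAt ℝ ∞ (fun y => g (t, y, f y)) x :=
  ContDiffAt.comp x (f := fun y => ((t, y, f y) : ℝ × ℝ × ℝ)) hg
    (contDiffAt_const.prodMk (contDiffAt_id.prodMk hf))

theorem deriv_curve_eventuallyEq (hg : ContDiffAt ℝ ∞ g (t, x, f x)) (hf : ContDiffAt ℝ ∞ f x) :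
    deriv (fun y => g (t, y, f y)) =ᶠ[𝓝 x]
      fun y => pdx g (t, y, f y) + pdu g (t, y, f y) * deriv f y := by
  have hc : ContinuousAt (fun y => ((t, y, f y) : ℝ × ℝ × ℝ)) x :=
    continuousAt_const.prodMk (continuousAt_id.prodMk hf.continuousAt)
  filter_upwards [hc.eventually (eventually_differentiableAt hg), eventually_differentiableAt hf]
    with y h1 h2
  exact (hasDerivAt_curve h1 h2).deriv

theorem deriv_curve (hg : ContDiffAt ℝ ∞ g (t, x, f x)) (hf : ContDiffAt ℝ ∞ f x) :
    deriv (fun y => g (t, y, f y)) x = total₁ g (t, x, f x) (deriv f x) :=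
  (deriv_curve_eventuallyEq hg hf).eq_of_nhds

theorem deriv_deriv_curve (hg : ContDiffAt ℝ ∞ g (t, x, f x)) (hf : ContDiffAt ℝ ∞ f x) :
    deriv (deriv (fun y => g (t, y, f y))) x =
      total₂ g (t, x, f x) (deriv f x) (deriv (deriv f) x) := by
  rw [(deriv_curve_eventuallyEq hg hf).deriv_eq]
  have h1 := hasDerivAt_curve (differentiableAt_of_smooth (contDiffAt_dirDeriv (e := (0, 1, 0)) hg))
    (differentiableAt_of_smooth hf)
  have h2 := hasDerivAt_curve (differentiableAt_of_smooth (contDiffAt_dirDeriv (e := (0, 0, 1)) hg))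
    (differentiableAt_of_smooth hf)
  have h3 := (differentiableAt_of_smooth (contDiffAt_deriv hf)).hasDerivAt
  rw [(h1.fun_add (h2.fun_mul h3)).deriv, total₂]
  ring

end Curve

theorem deriv_deriv_mul {f g : ℝ → ℝ} {x : ℝ} (hf : ContDiffAt ℝ ∞ f x) (hg : ContDiffAt ℝ ∞ g x) :
    deriv (deriv (fun y => f y * g y)) x =
      deriv (deriv f) x * g x + 2 * deriv f x * deriv g x + f x * deriv (deriv g) x := by
  have h : deriv (fun y => f y * g y) =ᶠ[𝓝 x] fun y => deriv f y * g y + f y * deriv g y := by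
    filter_upwards [eventually_differentiableAt hf, eventually_differentiableAt hg] with y h1 h2
    exact deriv_fun_mul h1 h2
  have f0 := (differentiableAt_of_smooth hf).hasDerivAt
  have g0 := (differentiableAt_of_smooth hg).hasDerivAt
  have f1 := (differentiableAt_of_smooth (contDiffAt_deriv hf)).hasDerivAt
  have g1 := (differentiableAt_of_smooth (contDiffAt_deriv hg)).hasDerivAt
  rw [h.deriv_eq, ((f1.fun_mul g0).fun_add (f0.fun_mul g1)).deriv]
  ring

theorem deriv_deriv_add {f g : ℝ → ℝ} {x : ℝ} (hf : ContDiffAt ℝ ∞ f x) (hg : ContDiffAt ℝ ∞ g x) :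
    deriv (deriv (fun y => f y + g y)) x = deriv (deriv f) x + deriv (deriv g) x := by
  have h : deriv (fun y => f y + g y) =ᶠ[𝓝 x] fun y => deriv f y + deriv g y := by
    filter_upwards [eventually_differentiableAt hf, eventually_differentiableAt hg] with y h1 h2
    exact deriv_fun_add h1 h2
  rw [h.deriv_eq]
  exact deriv_fun_add (differentiableAt_of_smooth (contDiffAt_deriv hf))
    (differentiableAt_of_smooth (contDiffAt_deriv hg))

theorem deriv_deriv_deriv_curve {g : ℝ × ℝ × ℝ → ℝ} {f : ℝ → ℝ} {t x : ℝ}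
    (hg : ContDiffAt ℝ ∞ g (t, x, f x)) (hf : ContDiffAt ℝ ∞ f x) :
    deriv (deriv (deriv (fun y => g (t, y, f y)))) x =
      total₃ g (t, x, f x) (deriv f x) (deriv (deriv f) x) (deriv (deriv (deriv f)) x) := by
  have hx := contDiffAt_dirDeriv (e := (0, 1, 0)) hg
  have hu := contDiffAt_dirDeriv (e := (0, 0, 1)) hg
  have hf' := contDiffAt_deriv hf
  rw [(deriv_curve_eventuallyEq hg hf).deriv.deriv_eq,
    deriv_deriv_add (contDiffAt_curve hx hf) ((contDiffAt_curve hu hf).mul hf'),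
    deriv_deriv_mul (contDiffAt_curve hu hf) hf', deriv_deriv_curve hx hf,
    deriv_deriv_curve hu hf, deriv_curve hu hf, total₃]
  ring

theorem iteratedDeriv_three (f : ℝ → ℝ) : iteratedDeriv 3 f = deriv (deriv (deriv f)) := by
  simp [iteratedDeriv_succ]

/-- The cubic polynomial in `(τ, ξ)` with vanishing constant term whose further coefficients
relevant for the equations of the class are prescribed. -/
noncomputable def jetPoly (v₁ v₂ r b c τ ξ : ℝ) : ℝ :=
  v₁ * τ + v₂ * ξ + r / 2 * ξ ^ 2 + b / 6 * τ ^ 3 + c / 6 * ξ ^ 3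

section JetPoly

variable {τ ξ : ℝ → ℝ} {x : ℝ}

theorem hasDerivAt_jetPoly (v₁ v₂ r b c : ℝ) {τ' ξ' : ℝ} (hτ : HasDerivAt τ τ' x)
    (hξ : HasDerivAt ξ ξ' x) :
    HasDerivAt (fun y => jetPoly v₁ v₂ r b c (τ y) (ξ y))
      ((v₁ + b / 2 * τ x ^ 2) * τ' + (v₂ + r * ξ x + c / 2 * ξ x ^ 2) * ξ') x := by
  have := ((((hτ.const_mul v₁).fun_add (hξ.const_mul v₂)).fun_add
    ((hξ.fun_pow 2).const_mul (r / 2))).fun_add ((hτ.fun_pow 3).const_mul (b / 6))).fun_add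
      ((hξ.fun_pow 3).const_mul (c / 6))
  convert! this using 1
  push_cast
  ring

theorem deriv_jetPoly_eventuallyEq (v₁ v₂ r b c : ℝ) (hτ : ContDiffAt ℝ ∞ τ x)
    (hξ : ContDiffAt ℝ ∞ ξ x) :
    deriv (fun y => jetPoly v₁ v₂ r b c (τ y) (ξ y)) =ᶠ[𝓝 x] fun y =>
      (v₁ + b / 2 * τ y ^ 2) * deriv τ y + (v₂ + r * ξ y + c / 2 * ξ y ^ 2) * deriv ξ y := by
  filter_upwards [eventually_differentiableAt hτ, eventually_differentiableAt hξ] with y h1 h2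
  exact (hasDerivAt_jetPoly v₁ v₂ r b c h1.hasDerivAt h2.hasDerivAt).deriv

theorem deriv_deriv_jetPoly_eventuallyEq (v₁ v₂ r b c : ℝ) (hτ : ContDiffAt ℝ ∞ τ x)
    (hξ : ContDiffAt ℝ ∞ ξ x) :
    deriv (deriv (fun y => jetPoly v₁ v₂ r b c (τ y) (ξ y))) =ᶠ[𝓝 x] fun y =>
      (v₁ + b / 2 * τ y ^ 2) * deriv (deriv τ) y + b * τ y * deriv τ y ^ 2 +
        ((v₂ + r * ξ y + c / 2 * ξ y ^ 2) * deriv (deriv ξ) y + (r + c * ξ y) * deriv ξ y ^ 2) := by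
  refine (deriv_jetPoly_eventuallyEq v₁ v₂ r b c hτ hξ).deriv.trans ?_
  filter_upwards [eventually_differentiableAt hτ, eventually_differentiableAt hξ,
    eventually_differentiableAt (contDiffAt_deriv hτ),
    eventually_differentiableAt (contDiffAt_deriv hξ)] with y h1 h2 h3 h4
  have := ((((h1.hasDerivAt.fun_pow 2).const_mul (b / 2)).const_add v₁).fun_mul
    h3.hasDerivAt).fun_add ((((h2.hasDerivAt.const_mul r).const_add v₂).fun_add
      ((h2.hasDerivAt.fun_pow 2).const_mul (c / 2))).fun_mul h4.hasDerivAt)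
  rw [this.deriv]
  push_cast
  ring

theorem deriv_deriv_deriv_jetPoly (v₁ v₂ r b c : ℝ) (hτ : ContDiffAt ℝ ∞ τ x)
    (hξ : ContDiffAt ℝ ∞ ξ x) (hτ0 : τ x = 0) (hξ0 : ξ x = 0) :
    deriv (deriv (deriv (fun y => jetPoly v₁ v₂ r b c (τ y) (ξ y)))) x =
      v₁ * deriv (deriv (deriv τ)) x + v₂ * deriv (deriv (deriv ξ)) x +
        3 * r * deriv ξ x * deriv (deriv ξ) x + b * deriv τ x ^ 3 + c * deriv ξ x ^ 3 := by
  rw [(deriv_deriv_jetPoly_eventuallyEq v₁ v₂ r b c hτ hξ).deriv_eq]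
  have t0 := (differentiableAt_of_smooth hτ).hasDerivAt
  have x0 := (differentiableAt_of_smooth hξ).hasDerivAt
  have t1 := (differentiableAt_of_smooth (contDiffAt_deriv hτ)).hasDerivAt
  have x1 := (differentiableAt_of_smooth (contDiffAt_deriv hξ)).hasDerivAt
  have t2 := (differentiableAt_of_smooth (contDiffAt_deriv (contDiffAt_deriv hτ))).hasDerivAt
  have x2 := (differentiableAt_of_smooth (contDiffAt_deriv (contDiffAt_deriv hξ))).hasDerivAt
  have := (((((t0.fun_pow 2).const_mul (b / 2)).const_add v₁).fun_mul t2).fun_add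
    ((t0.const_mul b).fun_mul (t1.fun_pow 2))).fun_add
    ((((((x0.const_mul r).const_add v₂).fun_add ((x0.fun_pow 2).const_mul (c / 2))).fun_mul
      x2)).fun_add (((x0.const_mul c).const_add r).fun_mul (x1.fun_pow 2)))
  rw [this.deriv, hτ0, hξ0]
  push_cast
  ring

end JetPoly


theorem isInvertible_of_apply_one_ne_zero {f : ℝ →L[ℝ] ℝ} (hf : f 1 ≠ 0) : f.IsInvertible :=
  ⟨ContinuousLinearEquiv.unitsEquivAut ℝ (Units.mk0 (f 1) hf), by ext; simp⟩

/-- A smooth function `H` of `(t, x, u)` with `H_u ≠ 0` at a zero of `H` defines a smooth germ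
`u (t, x)` with `H = 0` on its graph. -/
theorem exists_implicit {H : ℝ × ℝ × ℝ → ℝ} {t x w : ℝ} (hH : ContDiffAt ℝ ∞ H (t, x, w))
    (h0 : H (t, x, w) = 0) (hu : pdu H (t, x, w) ≠ 0) :
    ∃ u : ℝ × ℝ → ℝ, u (t, x) = w ∧ ContDiffAt ℝ ∞ u (t, x) ∧
      ∀ᶠ q in 𝓝 (t, x), H (q.1, q.2, u q) = 0 := by
  let a : (ℝ × ℝ) × ℝ →L[ℝ] ℝ × ℝ × ℝ :=
    ((ContinuousLinearMap.fst ℝ ℝ ℝ).comp (.fst ℝ (ℝ × ℝ) ℝ)).prod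
      (((ContinuousLinearMap.snd ℝ ℝ ℝ).comp (.fst ℝ (ℝ × ℝ) ℝ)).prod (.snd ℝ (ℝ × ℝ) ℝ))
  have ha : a ((t, x), w) = (t, x, w) := rfl
  have hs : ContDiffAt ℝ ∞ (H ∘ a) ((t, x), w) :=
    ContDiffAt.comp _ (by rwa [ha]) a.contDiff.contDiffAt
  have hd : fderiv ℝ (H ∘ a) ((t, x), w) = (fderiv ℝ H (t, x, w)).comp a := by
    rw [fderiv_comp _ (differentiableAt_of_smooth (by rwa [ha])) a.differentiableAt, a.fderiv, ha]
  have hi : (fderiv ℝ (H ∘ a) ((t, x), w) ∘L .inr ℝ (ℝ × ℝ) ℝ).IsInvertible := by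
    apply isInvertible_of_apply_one_ne_zero
    rw [hd]
    exact hu
  refine ⟨hs.implicitFunction (by simp) hi, hs.implicitFunction_apply_self (by simp) hi,
    hs.contDiffAt_implicitFunction (by simp) hi, ?_⟩
  filter_upwards [hs.eventually_apply_implicitFunction (by simp) hi] with q hq
  exact hq.trans h0

theorem hasDerivAt_time_curve {g : ℝ × ℝ × ℝ → ℝ} {u : ℝ × ℝ → ℝ} {t x : ℝ}
    (hg : ContDiffAt ℝ ∞ g (t, x, u (t, x))) (hu : ContDiffAt ℝ ∞ u (t, x)) :
    HasDerivAt (fun s => g (s, x, u (s, x)))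
      (pdt g (t, x, u (t, x)) + pdu g (t, x, u (t, x)) * deriv (fun s => u (s, x)) t) t := by
  have hf : DifferentiableAt ℝ (fun s => u (s, x)) t :=
    (differentiableAt_of_smooth hu).comp t (f := fun s => (s, x))
      (differentiableAt_id.prodMk (differentiableAt_const x))
  have hc : HasDerivAt (fun s => ((s, x, u (s, x)) : ℝ × ℝ × ℝ))
      (1, 0, deriv (fun s => u (s, x)) t) t :=
    (hasDerivAt_id t).prodMk ((hasDerivAt_const t x).prodMk hf.hasDerivAt)
  have := (differentiableAt_of_smooth hg).hasFDerivAt.comp_hasDerivAt t hc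
  rw [fderiv_apply_eq_partials] at this
  refine this.congr_deriv ?_
  ring

theorem holdsAt_jetPoly_iff (E : Equation) (w v₁ v₂ r b c t x : ℝ) :
    E.HoldsAt (fun q => w + jetPoly v₁ v₂ r b c (q.1 - t) (q.2 - x)) t x ↔
      v₁ + E.F t * w ^ 2 * v₂ + c = E.L t := by
  have ht : deriv (fun s => w + jetPoly v₁ v₂ r b c (s - t) (x - x)) t = v₁ := by
    have := (hasDerivAt_jetPoly v₁ v₂ r b c ((hasDerivAt_id t).sub_const t)
      (hasDerivAt_const t (x - x))).const_add w
    rw [show (fun s => w + jetPoly v₁ v₂ r b c (s - t) (x - x)) =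
      fun s => w + jetPoly v₁ v₂ r b c (id s - t) (x - x) from rfl, this.deriv]
    simp
  have hid : ContDiffAt ℝ ∞ (fun y : ℝ => y - x) x := contDiffAt_id.sub contDiffAt_const
  have hcs : ContDiffAt ℝ ∞ (fun _ : ℝ => t - t) x := contDiffAt_const
  have hd : deriv (fun y => w + jetPoly v₁ v₂ r b c (t - t) (y - x)) =
      deriv (fun y => jetPoly v₁ v₂ r b c (t - t) (y - x)) := by
    ext y
    exact deriv_const_add w
  have hx : deriv (fun y => w + jetPoly v₁ v₂ r b c (t - t) (y - x)) x = v₂ := by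
    rw [hd, (deriv_jetPoly_eventuallyEq v₁ v₂ r b c hcs hid).eq_of_nhds]
    simp
  have hxxx : iteratedDeriv 3 (fun y => w + jetPoly v₁ v₂ r b c (t - t) (y - x)) x = c := by
    rw [iteratedDeriv_three, hd, deriv_deriv_deriv_jetPoly v₁ v₂ r b c hcs hid (by simp) (by simp)]
    simp
  rw [Equation.HoldsAt, ht, hx, hxxx]
  simp [jetPoly]

/-- The jets of the germ defined implicitly by the inverse image under `φ` of the graph of a cubic
polynomial: their relation to the coefficients of the polynomial, and the equivalence of the
equations on both jets. -/
theorem exists_jet {φ : ℝ × ℝ × ℝ → ℝ × ℝ × ℝ} {Ω : Set (ℝ × ℝ × ℝ)} {E E' : Equation}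
    {T X U : ℝ × ℝ × ℝ → ℝ} (hφ : ∀ p, φ p = (T p, X p, U p)) {t x w : ℝ}
    (hT : ContDiffAt ℝ ∞ T (t, x, w)) (hX : ContDiffAt ℝ ∞ X (t, x, w))
    (hU : ContDiffAt ℝ ∞ U (t, x, w)) (htr : Transforms φ Ω E E') (hp : (t, x, w) ∈ Ω)
    (v₁ v₂ r b c : ℝ)
    (hK : pdu U (t, x, w) - v₁ * pdu T (t, x, w) - v₂ * pdu X (t, x, w) ≠ 0) :
    ∃ a₀ a₁ a₂ a₃ : ℝ,
      pdt U (t, x, w) + pdu U (t, x, w) * a₀ =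
        v₁ * (pdt T (t, x, w) + pdu T (t, x, w) * a₀) +
          v₂ * (pdt X (t, x, w) + pdu X (t, x, w) * a₀) ∧
      total₁ U (t, x, w) a₁ = v₁ * total₁ T (t, x, w) a₁ + v₂ * total₁ X (t, x, w) a₁ ∧
      total₂ U (t, x, w) a₁ a₂ = v₁ * total₂ T (t, x, w) a₁ a₂ + v₂ * total₂ X (t, x, w) a₁ a₂ +
        r * total₁ X (t, x, w) a₁ ^ 2 ∧
      total₃ U (t, x, w) a₁ a₂ a₃ = v₁ * total₃ T (t, x, w) a₁ a₂ a₃ +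
        v₂ * total₃ X (t, x, w) a₁ a₂ a₃ +
          3 * r * total₁ X (t, x, w) a₁ * total₂ X (t, x, w) a₁ a₂ +
            b * total₁ T (t, x, w) a₁ ^ 3 + c * total₁ X (t, x, w) a₁ ^ 3 ∧
      (a₀ + E.F t * w ^ 2 * a₁ + a₃ = E.L t ↔
        v₁ + E'.F (T (t, x, w)) * U (t, x, w) ^ 2 * v₂ + c = E'.L (T (t, x, w))) := by
  set p : ℝ × ℝ × ℝ := (t, x, w) with hpdef
  let P : ℝ × ℝ × ℝ → ℝ := fun q => jetPoly v₁ v₂ r b c (T q - T p) (X q - X p)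
  have hP : ContDiffAt ℝ ∞ P p := by
    simp only [P, jetPoly]
    fun_prop
  have hPu : pdu P p = v₁ * pdu T p + v₂ * pdu X p := by
    have line : ∀ g : ℝ × ℝ × ℝ → ℝ, ContDiffAt ℝ ∞ g p →
        HasDerivAt (fun z => g (t, x, z)) (pdu g p) w := fun g hg =>
      (differentiableAt_of_smooth hg).hasFDerivAt.comp_hasDerivAt w
        ((hasDerivAt_const w t).prodMk ((hasDerivAt_const w x).prodMk (hasDerivAt_id w)))
    have := hasDerivAt_jetPoly v₁ v₂ r b c ((line T hT).sub_const (T p))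
      ((line X hX).sub_const (X p))
    rw [(line P hP).unique this]
    simp [hpdef]
  let H : ℝ × ℝ × ℝ → ℝ := fun q => U q - U p - P q
  have hH : ContDiffAt ℝ ∞ H p := (hU.sub contDiffAt_const).sub hP
  have hHu : pdu H p ≠ 0 := by
    have : pdu H p = pdu U p - pdu P p := by
      simp only [dirDeriv, H]
      rw [fderiv_fun_sub ((differentiableAt_of_smooth hU).sub_const _)
        (differentiableAt_of_smooth hP), fderiv_sub_const]
      simp
    rw [this, hPu]
    convert! hK using 1
    ring
  obtain ⟨u, hu0, hus, huH⟩ := exists_implicit hH (by simp [H, P, jetPoly, ← hpdef]) hHu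
  let f : ℝ → ℝ := fun y => u (t, y)
  have hf0 : f x = w := hu0
  have hf : ContDiffAt ℝ ∞ f x :=
    ContDiffAt.comp x (f := fun y => (t, y)) hus (contDiffAt_const.prodMk contDiffAt_id)
  have hT' : ContDiffAt ℝ ∞ T (t, x, f x) := by rwa [hf0]
  have hX' : ContDiffAt ℝ ∞ X (t, x, f x) := by rwa [hf0]
  have hU' : ContDiffAt ℝ ∞ U (t, x, f x) := by rwa [hf0]
  let v : ℝ × ℝ → ℝ := fun q => U p + jetPoly v₁ v₂ r b c (q.1 - T p) (q.2 - X p)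
  have hv : ContDiffAt ℝ ∞ v (T p, X p) := by
    simp only [v, jetPoly]
    fun_prop
  have hgraph : CarriesGraph φ u v t x := by
    filter_upwards [huH] with q hq
    simp only [hφ, v, H, P] at hq ⊢
    linarith
  have hiff := htr.2 u v t x (T p) (X p) (U p) (by rwa [hu0]) (by rw [hu0, hφ]) hus hv hgraph
  rw [holdsAt_jetPoly_iff, Equation.HoldsAt, iteratedDeriv_three, hu0] at hiff
  have hxline : (fun y => U (t, y, f y)) =ᶠ[𝓝 x] fun y => U p +
      jetPoly v₁ v₂ r b c (T (t, y, f y) - T p) (X (t, y, f y) - X p) := by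
    have hc : ContinuousAt (fun y => (t, y)) x := continuousAt_const.prodMk continuousAt_id
    filter_upwards [hc.eventually huH] with y hy
    simp only [H, P, f] at hy ⊢
    linarith
  have htline : (fun s => U (s, x, u (s, x))) =ᶠ[𝓝 t] fun s => U p +
      jetPoly v₁ v₂ r b c (T (s, x, u (s, x)) - T p) (X (s, x, u (s, x)) - X p) := by
    have hc : ContinuousAt (fun s => (s, x)) t := continuousAt_id.prodMk continuousAt_const
    filter_upwards [hc.eventually huH] with s hs
    simp only [H, P] at hs ⊢
    linarith
  have hτ : ContDiffAt ℝ ∞ (fun y => T (t, y, f y) - T p) x :=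
    (contDiffAt_curve hT' hf).sub contDiffAt_const
  have hξ : ContDiffAt ℝ ∞ (fun y => X (t, y, f y) - X p) x :=
    (contDiffAt_curve hX' hf).sub contDiffAt_const
  have hdτ : deriv (fun y => T (t, y, f y) - T p) = deriv (fun y => T (t, y, f y)) := by
    ext y
    exact deriv_sub_const _
  have hdξ : deriv (fun y => X (t, y, f y) - X p) = deriv (fun y => X (t, y, f y)) := by
    ext y
    exact deriv_sub_const _
  have hdV : deriv (fun y => U p +
      jetPoly v₁ v₂ r b c (T (t, y, f y) - T p) (X (t, y, f y) - X p)) =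
      deriv (fun y => jetPoly v₁ v₂ r b c (T (t, y, f y) - T p) (X (t, y, f y) - X p)) := by
    ext y
    exact deriv_const_add _
  have hτ0 : T (t, x, f x) - T p = 0 := by rw [hf0, sub_self]
  have hξ0 : X (t, x, f x) - X p = 0 := by rw [hf0, sub_self]
  have hU1 := hxline.deriv
  rw [hdV] at hU1
  refine ⟨deriv (fun s => u (s, x)) t, deriv f x, deriv (deriv f) x, deriv (deriv (deriv f)) x,
    ?_, ?_, ?_, ?_, hiff⟩
  · have h1 := hasDerivAt_time_curve (g := U) (by rwa [hu0]) hus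
    have h2 := (hasDerivAt_time_curve (g := T) (by rwa [hu0]) hus).sub_const (T p)
    have h3 := (hasDerivAt_time_curve (g := X) (by rwa [hu0]) hus).sub_const (X p)
    have h4 := (hasDerivAt_jetPoly v₁ v₂ r b c h2 h3).const_add (U p)
    have := h1.unique (h4.congr_of_eventuallyEq htline)
    rw [hu0] at this
    simpa [hpdef] using this
  · have h := hU1.eq_of_nhds
    rw [(deriv_jetPoly_eventuallyEq v₁ v₂ r b c hτ hξ).eq_of_nhds, hdτ, hdξ, deriv_curve hU' hf,
      deriv_curve hT' hf, deriv_curve hX' hf, hτ0, hξ0, hf0] at h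
    simpa using h
  · have h := hU1.deriv.eq_of_nhds
    rw [(deriv_deriv_jetPoly_eventuallyEq v₁ v₂ r b c hτ hξ).eq_of_nhds, hdτ, hdξ,
      deriv_deriv_curve hU' hf, deriv_deriv_curve hT' hf, deriv_deriv_curve hX' hf,
      deriv_curve hX' hf, hτ0, hξ0, hf0] at h
    rw [h]
    ring
  · have h := hU1.deriv.deriv.eq_of_nhds
    rw [deriv_deriv_deriv_jetPoly v₁ v₂ r b c hτ hξ hτ0 hξ0, hdτ, hdξ,
      deriv_deriv_deriv_curve hU' hf, deriv_deriv_deriv_curve hT' hf,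
      deriv_deriv_deriv_curve hX' hf, deriv_deriv_curve hX' hf,
      deriv_curve hX' hf, deriv_curve hT' hf, hf0] at h
    rw [h]


/-- `T`, `X`, `U` are the components of an admissible transformation from `E` to `E'` with
domain `Ω`. -/
structure AdmissibleComponents (E E' : Equation) (Ω : Set (ℝ × ℝ × ℝ))
    (T X U : ℝ × ℝ × ℝ → ℝ) : Prop where
  isOpen : IsOpen Ω
  isConnected : IsConnected Ω
  smooth_T : ∀ p ∈ Ω, ContDiffAt ℝ ∞ T p
  smooth_X : ∀ p ∈ Ω, ContDiffAt ℝ ∞ X p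
  smooth_U : ∀ p ∈ Ω, ContDiffAt ℝ ∞ U p
  kernel_trivial : ∀ p ∈ Ω, ∀ a b c : ℝ, pdt T p * a + pdx T p * b + pdu T p * c = 0 →
    pdt X p * a + pdx X p * b + pdu X p * c = 0 → pdt U p * a + pdx U p * b + pdu U p * c = 0 →
    a = 0 ∧ b = 0 ∧ c = 0
  time_mem : ∀ p ∈ Ω, p.1 ∈ E.interval
  transforms : Transforms (fun p => (T p, X p, U p)) Ω E E'

theorem IsAdmissible.components {E E' : Equation} {φ : ℝ × ℝ × ℝ → ℝ × ℝ × ℝ}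
    {Ω : Set (ℝ × ℝ × ℝ)} (h : IsAdmissible E E' φ Ω) :
    AdmissibleComponents E E' Ω (fun p => (φ p).1) (fun p => (φ p).2.1) (fun p => (φ p).2.2) := by
  obtain ⟨⟨ho, hc, hs, hn⟩, htm, htr⟩ := h
  have hφ : ∀ p ∈ Ω, ContDiffAt ℝ ∞ φ p := fun p hp => hs.contDiffAt (ho.mem_nhds hp)
  refine ⟨ho, hc, fun p hp => (hφ p hp).fst, fun p hp => (hφ p hp).snd.fst,
    fun p hp => (hφ p hp).snd.snd, ?_, htm, htr⟩
  intro p hp a b c h1 h2 h3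
  have hd := (differentiableAt_of_smooth (hφ p hp)).hasFDerivAt
  rw [← fderiv_apply_eq_partials] at h1 h2 h3
  rw [hd.fst.fderiv] at h1
  rw [hd.snd.fst.fderiv] at h2
  rw [hd.snd.snd.fderiv] at h3
  have h0 : fderiv ℝ φ p (a, b, c) = 0 := Prod.ext h1 (Prod.ext h2 h3)
  have := (LinearMap.equivOfDetNeZero _ (hn p hp)).injective
    (a₁ := (a, b, c)) (a₂ := 0) (by rw [map_zero]; exact h0)
  simpa using this

theorem dirDeriv_eq_zero_of_eqOn_zero {Ω : Set (ℝ × ℝ × ℝ)} (hΩ : IsOpen Ω)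
    {g : ℝ × ℝ × ℝ → ℝ} (hg : ∀ p ∈ Ω, g p = 0) (e : ℝ × ℝ × ℝ) :
    ∀ p ∈ Ω, dirDeriv e g p = 0 := by
  intro p hp
  have : g =ᶠ[𝓝 p] fun _ => 0 := by
    filter_upwards [hΩ.mem_nhds hp] with q hq using hg q hq
  rw [dirDeriv_congr this]
  simp [dirDeriv]

section Totals

variable {Ω : Set (ℝ × ℝ × ℝ)} {g : ℝ × ℝ × ℝ → ℝ} {p : ℝ × ℝ × ℝ}

theorem total₁_eq_zero (hx : pdx g p = 0) (hu : pdu g p = 0) (a : ℝ) : total₁ g p a = 0 := by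
  simp [total₁, hx, hu]

theorem total₂_eq_zero (hΩ : IsOpen Ω) (hx : ∀ p ∈ Ω, pdx g p = 0) (hu : ∀ p ∈ Ω, pdu g p = 0)
    (hp : p ∈ Ω) (a b : ℝ) : total₂ g p a b = 0 := by
  have h := dirDeriv_eq_zero_of_eqOn_zero hΩ hx
  have h' := dirDeriv_eq_zero_of_eqOn_zero hΩ hu
  rw [total₂, total₁_eq_zero (h _ p hp) (h _ p hp), total₁_eq_zero (h' _ p hp) (h' _ p hp),
    hu p hp]
  ring

theorem total₃_eq_zero (hΩ : IsOpen Ω) (hx : ∀ p ∈ Ω, pdx g p = 0) (hu : ∀ p ∈ Ω, pdu g p = 0)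
    (hp : p ∈ Ω) (a b c : ℝ) : total₃ g p a b c = 0 := by
  have h := dirDeriv_eq_zero_of_eqOn_zero hΩ hx
  have h' := dirDeriv_eq_zero_of_eqOn_zero hΩ hu
  rw [total₃, total₂_eq_zero hΩ (h _) (h _) hp, total₂_eq_zero hΩ (h' _) (h' _) hp,
    total₁_eq_zero (h' _ p hp) (h' _ p hp), hu p hp]
  ring

theorem total₂_eq_add (g : ℝ × ℝ × ℝ → ℝ) (p : ℝ × ℝ × ℝ) (a b : ℝ) :
    total₂ g p a b = total₂ g p a 0 + pdu g p * b := by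
  simp [total₂]

theorem total₃_eq_add (g : ℝ × ℝ × ℝ → ℝ) (p : ℝ × ℝ × ℝ) (a b c : ℝ) :
    total₃ g p a b c = total₃ g p a b 0 + pdu g p * c := by
  simp [total₃]

end Totals

namespace AdmissibleComponents

variable {E E' : Equation} {Ω : Set (ℝ × ℝ × ℝ)} {T X U : ℝ × ℝ × ℝ → ℝ} {p : ℝ × ℝ × ℝ}

theorem exists_jet (h : AdmissibleComponents E E' Ω T X U) (hp : p ∈ Ω) (v₁ v₂ r b c : ℝ)
    (hK : pdu U p - v₁ * pdu T p - v₂ * pdu X p ≠ 0)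
    (hE : v₁ + E'.F (T p) * U p ^ 2 * v₂ + c = E'.L (T p)) :
    ∃ a₀ a₁ a₂ a₃ : ℝ,
      pdt U p + pdu U p * a₀ = v₁ * (pdt T p + pdu T p * a₀) + v₂ * (pdt X p + pdu X p * a₀) ∧
      total₁ U p a₁ = v₁ * total₁ T p a₁ + v₂ * total₁ X p a₁ ∧
      total₂ U p a₁ a₂ = v₁ * total₂ T p a₁ a₂ + v₂ * total₂ X p a₁ a₂ + r * total₁ X p a₁ ^ 2 ∧
      total₃ U p a₁ a₂ a₃ = v₁ * total₃ T p a₁ a₂ a₃ + v₂ * total₃ X p a₁ a₂ a₃ +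
          3 * r * total₁ X p a₁ * total₂ X p a₁ a₂ + b * total₁ T p a₁ ^ 3 +
            c * total₁ X p a₁ ^ 3 ∧
      a₀ + E.F p.1 * p.2.2 ^ 2 * a₁ + a₃ = E.L p.1 := by
  obtain ⟨t, x, w⟩ := p
  obtain ⟨a₀, a₁, a₂, a₃, h0, h1, h2, h3, h4⟩ := ForcedMKdV.exists_jet (fun _ => rfl)
    (h.smooth_T _ hp) (h.smooth_X _ hp) (h.smooth_U _ hp) h.transforms hp v₁ v₂ r b c hK
  exact ⟨a₀, a₁, a₂, a₃, h0, h1, h2, h3, h4.2 hE⟩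

theorem pdx_T_mul_eq (h : AdmissibleComponents E E' Ω T X U) (hp : p ∈ Ω) (v₁ v₂ : ℝ)
    (hK : pdu U p - v₁ * pdu T p - v₂ * pdu X p ≠ 0) :
    pdx T p * (pdu U p - v₂ * pdu X p) = pdu T p * (pdx U p - v₂ * pdx X p) := by
  obtain ⟨a₀, a₁, a₂, a₃, h0, h1, h2, h3, h4⟩ := h.exists_jet hp v₁ v₂ 0 0
    (E'.L (T p) - v₁ - E'.F (T p) * U p ^ 2 * v₂) hK (by ring)
  obtain ⟨b₀, b₁, b₂, b₃, k0, k1, k2, k3, k4⟩ := h.exists_jet hp v₁ v₂ 0 1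
    (E'.L (T p) - v₁ - E'.F (T p) * U p ^ 2 * v₂) hK (by ring)
  obtain rfl : a₀ = b₀ := mul_left_cancel₀ hK (by linear_combination h0 - k0)
  obtain rfl : a₁ = b₁ := by
    simp only [total₁] at h1 k1
    exact mul_left_cancel₀ hK (by linear_combination h1 - k1)
  obtain rfl : a₂ = b₂ := by
    rw [total₂_eq_add U, total₂_eq_add T, total₂_eq_add X] at h2 k2
    exact mul_left_cancel₀ hK (by linear_combination h2 - k2)
  obtain rfl : a₃ = b₃ := by linarith
  have h5 : total₁ T p a₁ = 0 := pow_eq_zero_iff (n := 3) (by simp) |>.1 (by linarith)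
  simp only [total₁] at h1 h5
  linear_combination (pdu U p - v₁ * pdu T p - v₂ * pdu X p) * h5 - pdu T p * h1

theorem pd_T_eq_zero (h : AdmissibleComponents E E' Ω T X U) (hp : p ∈ Ω) :
    pdx T p = 0 ∧ pdu T p = 0 := by
  have key := fun v₁ v₂ => h.pdx_T_mul_eq hp v₁ v₂
  have hker := h.kernel_trivial p hp
  by_cases hTu : pdu T p = 0
  · refine ⟨?_, hTu⟩
    have hor : pdu U p ≠ 0 ∨ pdu U p - pdu X p ≠ 0 := by
      by_contra! hcon
      have := (hker 0 0 1 (by simp [hTu]) (by linarith) (by linarith)).2.2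
      norm_num at this
    rcases hor with h0 | h0
    · have := key 0 0 (by simpa using h0)
      simpa [hTu, h0] using this
    · have := key 0 1 (by simpa using h0)
      simpa [hTu, h0] using this
  · exfalso
    have all : ∀ v₂, pdx T p * (pdu U p - v₂ * pdu X p) = pdu T p * (pdx U p - v₂ * pdx X p) := by
      intro v₂
      refine key ((pdu U p - v₂ * pdu X p - 1) / pdu T p) v₂ ?_
      have : pdu U p - (pdu U p - v₂ * pdu X p - 1) / pdu T p * pdu T p - v₂ * pdu X p = 1 := by
        field_simp
        ring
      rw [this]
      exact one_ne_zero
    have e0 := all 0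
    have e1 := all 1
    exact hTu (hker 0 (pdu T p) (-pdx T p) (by ring) (by linear_combination e1 - e0)
      (by linear_combination -e0)).2.1

theorem pdx_T (h : AdmissibleComponents E E' Ω T X U) : ∀ p ∈ Ω, pdx T p = 0 :=
  fun _ hp => (h.pd_T_eq_zero hp).1

theorem pdu_T (h : AdmissibleComponents E E' Ω T X U) : ∀ p ∈ Ω, pdu T p = 0 :=
  fun _ hp => (h.pd_T_eq_zero hp).2

theorem pdt_T_mul_cube (h : AdmissibleComponents E E' Ω T X U) (hp : p ∈ Ω) (v₂ : ℝ)
    (hK : pdu U p - v₂ * pdu X p ≠ 0) :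
    (pdu U p - v₂ * pdu X p) ^ 3 * pdt T p = (pdx X p * pdu U p - pdu X p * pdx U p) ^ 3 := by
  have hTx := h.pdx_T p hp
  have hTu := h.pdu_T p hp
  have t1 := total₁_eq_zero hTx hTu
  have t2 := total₂_eq_zero h.isOpen h.pdx_T h.pdu_T hp
  have t3 := total₃_eq_zero h.isOpen h.pdx_T h.pdu_T hp
  obtain ⟨a₀, a₁, a₂, a₃, h0, h1, h2, h3, h4⟩ := h.exists_jet hp
    (E'.L (T p) - E'.F (T p) * U p ^ 2 * v₂) v₂ 0 0 0 (by simpa [hTu] using hK) (by ring)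
  obtain ⟨b₀, b₁, b₂, b₃, k0, k1, k2, k3, k4⟩ := h.exists_jet hp
    (E'.L (T p) - E'.F (T p) * U p ^ 2 * v₂ - 1) v₂ 0 0 1 (by simpa [hTu] using hK) (by ring)
  simp only [t1, t2, t3, hTu] at h0 h1 h2 h3 k0 k1 k2 k3
  obtain rfl : a₁ = b₁ := by
    simp only [total₁] at h1 k1
    exact mul_left_cancel₀ hK (by linear_combination h1 - k1)
  obtain rfl : a₂ = b₂ := by
    rw [total₂_eq_add U, total₂_eq_add X] at h2 k2
    exact mul_left_cancel₀ hK (by linear_combination h2 - k2)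
  rw [total₃_eq_add U, total₃_eq_add X] at h3 k3
  have e : pdt T p = total₁ X p a₁ ^ 3 := by
    linear_combination -h0 + k0 - h3 + k3 + (pdu U p - v₂ * pdu X p) * (h4 - k4)
  have e' : (pdu U p - v₂ * pdu X p) * total₁ X p a₁ = pdx X p * pdu U p - pdu X p * pdx U p := by
    simp only [total₁] at h1 ⊢
    linear_combination pdu X p * h1
  rw [e, ← mul_pow, e']

theorem jacobian_ne_zero (h : AdmissibleComponents E E' Ω T X U) (hp : p ∈ Ω) :
    pdx X p * pdu U p - pdu X p * pdx U p ≠ 0 := by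
  intro hJ
  have hTx := h.pdx_T p hp
  have hTu := h.pdu_T p hp
  have hker := h.kernel_trivial p hp
  obtain ⟨-, hXu, hXx⟩ := hker 0 (pdu X p) (-pdx X p) (by simp [hTx, hTu]) (by ring)
    (by linear_combination -hJ)
  obtain ⟨-, hUu, hUx⟩ := hker 0 (pdu U p) (-pdx U p) (by simp [hTx, hTu])
    (by linear_combination hJ) (by ring)
  have := (hker 0 0 1 (by simp [hTu]) (by simp [hXu]) (by simp [hUu])).2.2
  norm_num at this

theorem pdu_X (h : AdmissibleComponents E E' Ω T X U) : ∀ p ∈ Ω, pdu X p = 0 := by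
  intro p hp
  by_contra hXu
  have key : ∀ k : ℝ, k ≠ 0 →
      k ^ 3 * pdt T p = (pdx X p * pdu U p - pdu X p * pdx U p) ^ 3 := by
    intro k hk
    have e : pdu U p - (pdu U p - k) / pdu X p * pdu X p = k := by
      field_simp
      ring
    have := h.pdt_T_mul_cube hp ((pdu U p - k) / pdu X p) (by rwa [e])
    rwa [e] at this
  have h1 := key 1 one_ne_zero
  have h2 := key 2 two_ne_zero
  exact h.jacobian_ne_zero hp (pow_eq_zero_iff (n := 3) (by simp) |>.1 (by linarith))

theorem pdx_X_ne_zero (h : AdmissibleComponents E E' Ω T X U) (hp : p ∈ Ω) : pdx X p ≠ 0 := by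
  have := h.jacobian_ne_zero hp
  rw [h.pdu_X p hp] at this
  exact left_ne_zero_of_mul (by simpa using this)

theorem pdu_U_ne_zero (h : AdmissibleComponents E E' Ω T X U) (hp : p ∈ Ω) : pdu U p ≠ 0 := by
  have := h.jacobian_ne_zero hp
  rw [h.pdu_X p hp] at this
  exact right_ne_zero_of_mul (by simpa using this)

theorem pdt_T (h : AdmissibleComponents E E' Ω T X U) (hp : p ∈ Ω) :
    pdt T p = pdx X p ^ 3 := by
  have hU := h.pdu_U_ne_zero hp
  have := h.pdt_T_mul_cube hp 0 (by simpa using hU)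
  rw [h.pdu_X p hp] at this
  refine mul_left_cancel₀ (pow_ne_zero 3 hU) ?_
  linear_combination this

end AdmissibleComponents


section Lines

variable {g : ℝ × ℝ × ℝ → ℝ} {t x w : ℝ}

theorem hasDerivAt_line_u (hg : DifferentiableAt ℝ g (t, x, w)) :
    HasDerivAt (fun z => g (t, x, z)) (pdu g (t, x, w)) w :=
  hg.hasFDerivAt.comp_hasDerivAt w
    ((hasDerivAt_const w t).prodMk ((hasDerivAt_const w x).prodMk (hasDerivAt_id w)))

theorem hasDerivAt_line_x (hg : DifferentiableAt ℝ g (t, x, w)) :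
    HasDerivAt (fun y => g (t, y, w)) (pdx g (t, x, w)) x :=
  hg.hasFDerivAt.comp_hasDerivAt x
    ((hasDerivAt_const x t).prodMk ((hasDerivAt_id x).prodMk (hasDerivAt_const x w)))

theorem hasDerivAt_line_t (hg : DifferentiableAt ℝ g (t, x, w)) :
    HasDerivAt (fun s => g (s, x, w)) (pdt g (t, x, w)) t :=
  hg.hasFDerivAt.comp_hasDerivAt t
    ((hasDerivAt_id t).prodMk ((hasDerivAt_const t x).prodMk (hasDerivAt_const t w)))

variable {Ω : Set (ℝ × ℝ × ℝ)}

theorem eventually_line_u (hΩ : IsOpen Ω) (hp : (t, x, w) ∈ Ω) : ∀ᶠ z in 𝓝 w, (t, x, z) ∈ Ω :=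
  ContinuousAt.eventually_mem (f := fun z => (t, x, z)) (by fun_prop) (hΩ.mem_nhds hp)

theorem eventually_line_x (hΩ : IsOpen Ω) (hp : (t, x, w) ∈ Ω) : ∀ᶠ y in 𝓝 x, (t, y, w) ∈ Ω :=
  ContinuousAt.eventually_mem (f := fun y => (t, y, w)) (by fun_prop) (hΩ.mem_nhds hp)

theorem eventually_line_t (hΩ : IsOpen Ω) (hp : (t, x, w) ∈ Ω) : ∀ᶠ s in 𝓝 t, (s, x, w) ∈ Ω :=
  ContinuousAt.eventually_mem (f := fun s => (s, x, w)) (by fun_prop) (hΩ.mem_nhds hp)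

end Lines

namespace AdmissibleComponents

variable {E E' : Equation} {Ω : Set (ℝ × ℝ × ℝ)} {T X U : ℝ × ℝ × ℝ → ℝ} {p : ℝ × ℝ × ℝ}

theorem pdu_pdx_X (h : AdmissibleComponents E E' Ω T X U) : ∀ p ∈ Ω, pdu (pdx X) p = 0 := by
  intro p hp
  refine (dirDeriv_comm (h.smooth_X p hp) _ _).trans ?_
  exact dirDeriv_eq_zero_of_eqOn_zero h.isOpen h.pdu_X _ p hp

theorem pdx_pdx_X (h : AdmissibleComponents E E' Ω T X U) : ∀ p ∈ Ω, pdx (pdx X) p = 0 := by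
  rintro ⟨t, x, w⟩ hp
  have h1 := hasDerivAt_line_x (differentiableAt_of_smooth
    (contDiffAt_dirDeriv (e := (1, 0, 0)) (h.smooth_T _ hp)))
  have h2 := (hasDerivAt_line_x (differentiableAt_of_smooth
    (contDiffAt_dirDeriv (e := (0, 1, 0)) (h.smooth_X _ hp)))).fun_pow 3
  have he : (fun y => pdt T (t, y, w)) =ᶠ[𝓝 x] fun y => pdx X (t, y, w) ^ 3 :=
    (eventually_line_x h.isOpen hp).mono fun y hy => h.pdt_T hy
  have h3 := (h1.congr_of_eventuallyEq he.symm).unique h2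
  have hz : pdx (pdt T) (t, x, w) = 0 := (dirDeriv_comm (h.smooth_T _ hp) _ _).trans
    (dirDeriv_eq_zero_of_eqOn_zero h.isOpen h.pdx_T _ _ hp)
  rw [hz] at h3
  simpa [h.pdx_X_ne_zero hp] using h3.symm

/-- The equation of the target class, expressed in the jet variables of the source and restricted
to the source equation; `a = u_x` and `b = u_xx` are free. -/
theorem jet_identity (h : AdmissibleComponents E E' Ω T X U) (hp : p ∈ Ω) (a b : ℝ) :
    pdx X p ^ 3 * (E'.L (T p) - E'.F (T p) * U p ^ 2 * (total₁ U p a / pdx X p)) +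
      total₁ U p a / pdx X p * pdt X p - pdt U p + E.F p.1 * p.2.2 ^ 2 * (pdu U p * a) -
        total₃ U p a b 0 = E.L p.1 * pdu U p := by
  have hX := h.pdx_X_ne_zero hp
  have hU := h.pdu_U_ne_zero hp
  have hTu := h.pdu_T p hp
  have hXu := h.pdu_X p hp
  have hXu0 := dirDeriv_eq_zero_of_eqOn_zero h.isOpen h.pdu_X
  have t1 := total₁_eq_zero (h.pdx_T p hp) hTu
  have t2 := total₂_eq_zero h.isOpen h.pdx_T h.pdu_T hp
  have t3 := total₃_eq_zero h.isOpen h.pdx_T h.pdu_T hp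
  have x1 : ∀ a, total₁ X p a = pdx X p := by simp [total₁, hXu]
  have x2 : ∀ a b, total₂ X p a b = 0 := by
    intro a b
    rw [total₂, total₁_eq_zero (h.pdx_pdx_X p hp) (h.pdu_pdx_X p hp),
      total₁_eq_zero (hXu0 _ p hp) (hXu0 _ p hp), hXu]
    ring
  have x3 : ∀ a b c, total₃ X p a b c = 0 := by
    intro a b c
    rw [total₃, total₂_eq_zero h.isOpen h.pdx_pdx_X h.pdu_pdx_X hp,
      total₂_eq_zero h.isOpen (hXu0 _) (hXu0 _) hp,
      total₁_eq_zero (hXu0 _ p hp) (hXu0 _ p hp), hXu]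
    ring
  obtain ⟨v₂, hv₂⟩ : ∃ v₂, v₂ = total₁ U p a / pdx X p := ⟨_, rfl⟩
  obtain ⟨a₀, a₁, a₂, a₃, h0, h1, h2, h3, h4⟩ := h.exists_jet hp
    (E'.L (T p) - E'.F (T p) * U p ^ 2 * v₂) v₂ (total₂ U p a b / pdx X p ^ 2) 0 0
    (by simpa [hTu, hXu] using hU) (by ring)
  rw [← hv₂]
  rw [eq_div_iff hX] at hv₂
  simp only [t1, t2, t3, x1, x2, x3, hTu, hXu] at h0 h1 h2 h3
  obtain rfl : a₁ = a := by
    simp only [total₁] at h1 hv₂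
    exact mul_left_cancel₀ hU (by linear_combination h1 + hv₂)
  obtain rfl : a₂ = b := by
    rw [div_mul_cancel₀ _ (pow_ne_zero 2 hX), total₂_eq_add U, total₂_eq_add U p a₁ b] at h2
    exact mul_left_cancel₀ hU (by linear_combination h2)
  rw [total₃_eq_add] at h3
  rw [h.pdt_T hp] at h0
  linear_combination pdu U p * h4 - h0 - h3

theorem mixed_pd_U (h : AdmissibleComponents E E' Ω T X U) (hp : p ∈ Ω) :
    pdu (pdx U) p = 0 ∧ pdu (pdu U) p = 0 := by
  have key : ∀ a, pdu (pdx U) p + pdu (pdu U) p * a = 0 := by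
    intro a
    have h0 := h.jet_identity hp a 0
    have h1 := h.jet_identity hp a 1
    have hc : pdx (pdu U) p = pdu (pdx U) p := dirDeriv_comm (h.smooth_U p hp) _ _
    simp only [total₃, total₂_eq_add _ p a 1, total₁, hc] at h0 h1
    linear_combination (h0 - h1) / 3
  have k0 := key 0
  have k1 := key 1
  constructor <;> linarith

theorem pdu_pdx_U (h : AdmissibleComponents E E' Ω T X U) : ∀ p ∈ Ω, pdu (pdx U) p = 0 :=
  fun _ hp => (h.mixed_pd_U hp).1

theorem pdu_pdu_U (h : AdmissibleComponents E E' Ω T X U) : ∀ p ∈ Ω, pdu (pdu U) p = 0 :=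
  fun _ hp => (h.mixed_pd_U hp).2

theorem pdx_pdu_U (h : AdmissibleComponents E E' Ω T X U) : ∀ p ∈ Ω, pdx (pdu U) p = 0 := by
  intro p hp
  refine (dirDeriv_comm (h.smooth_U p hp) _ _).trans ?_
  exact h.pdu_pdx_U p hp

theorem total₃_U (h : AdmissibleComponents E E' Ω T X U) (hp : p ∈ Ω) (a : ℝ) :
    total₃ U p a 0 0 = pdx (pdx (pdx U)) p := by
  have e : pdu (pdx (pdx U)) p = 0 := by
    refine (dirDeriv_comm (contDiffAt_dirDeriv (h.smooth_U p hp)) _ _).trans ?_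
    exact dirDeriv_eq_zero_of_eqOn_zero h.isOpen h.pdu_pdx_U _ p hp
  have hz := dirDeriv_eq_zero_of_eqOn_zero h.isOpen h.pdu_pdx_U
  rw [total₃, total₂_eq_zero h.isOpen h.pdx_pdu_U h.pdu_pdu_U hp, total₂, total₁, e,
    total₁_eq_zero (hz _ p hp) (hz _ p hp)]
  ring

theorem coefficient_u_x (h : AdmissibleComponents E E' Ω T X U) (hp : p ∈ Ω) :
    pdx X p * E.F p.1 * p.2.2 ^ 2 = pdx X p ^ 3 * E'.F (T p) * U p ^ 2 - pdt X p := by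
  have hX := h.pdx_X_ne_zero hp
  have hU := h.pdu_U_ne_zero hp
  have h0 := h.jet_identity hp 0 0
  have h1 := h.jet_identity hp 1 0
  rw [h.total₃_U hp] at h0 h1
  simp only [total₁] at h0 h1
  field_simp at h0 h1
  refine mul_left_cancel₀ hU ?_
  linear_combination h1 - h0

theorem hasDerivAt_comp_T (h : AdmissibleComponents E E' Ω T X U) {t x w : ℝ}
    (hp : (t, x, w) ∈ Ω) {f : ℝ → ℝ} (hf : ContDiffOn ℝ ∞ f E'.interval) :
    HasDerivAt (fun z => f (T (t, x, z))) 0 w := by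
  have h1 := hasDerivAt_line_u (differentiableAt_of_smooth (h.smooth_T _ hp))
  have h2 := (differentiableAt_of_smooth (hf.contDiffAt
    (E'.isOpen_interval.mem_nhds (h.transforms.1 _ hp)))).hasDerivAt.comp w h1
  rw [h.pdu_T _ hp, mul_zero] at h2
  exact h2

theorem hasDerivAt_pdx_X (h : AdmissibleComponents E E' Ω T X U) {t x w : ℝ}
    (hp : (t, x, w) ∈ Ω) : HasDerivAt (fun z => pdx X (t, x, z)) 0 w := by
  have := hasDerivAt_line_u (differentiableAt_of_smooth
    (contDiffAt_dirDeriv (e := (0, 1, 0)) (h.smooth_X _ hp)))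
  rwa [h.pdu_pdx_X _ hp] at this

theorem hasDerivAt_pdt_X (h : AdmissibleComponents E E' Ω T X U) {t x w : ℝ}
    (hp : (t, x, w) ∈ Ω) : HasDerivAt (fun z => pdt X (t, x, z)) 0 w := by
  have := hasDerivAt_line_u (differentiableAt_of_smooth
    (contDiffAt_dirDeriv (e := (1, 0, 0)) (h.smooth_X _ hp)))
  have hz : pdu (pdt X) (t, x, w) = 0 := (dirDeriv_comm (h.smooth_X _ hp) _ _).trans
    (dirDeriv_eq_zero_of_eqOn_zero h.isOpen h.pdu_X _ _ hp)
  rwa [hz] at this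

theorem hasDerivAt_U (h : AdmissibleComponents E E' Ω T X U) {t x w : ℝ}
    (hp : (t, x, w) ∈ Ω) : HasDerivAt (fun z => U (t, x, z)) (pdu U (t, x, w)) w :=
  hasDerivAt_line_u (differentiableAt_of_smooth (h.smooth_U _ hp))

theorem hasDerivAt_pdu_U (h : AdmissibleComponents E E' Ω T X U) {t x w : ℝ}
    (hp : (t, x, w) ∈ Ω) : HasDerivAt (fun z => pdu U (t, x, z)) 0 w := by
  have := hasDerivAt_line_u (differentiableAt_of_smooth
    (contDiffAt_dirDeriv (e := (0, 0, 1)) (h.smooth_U _ hp)))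
  rwa [h.pdu_pdu_U _ hp] at this

theorem coefficient_u_x_deriv (h : AdmissibleComponents E E' Ω T X U) (hp : p ∈ Ω) :
    pdx X p * E.F p.1 * p.2.2 = pdx X p ^ 3 * E'.F (T p) * (U p * pdu U p) := by
  obtain ⟨t, x, w⟩ := p
  have hL := ((h.hasDerivAt_pdx_X hp).mul_const (E.F t)).fun_mul ((hasDerivAt_id w).fun_pow 2)
  have hR := ((((h.hasDerivAt_pdx_X hp).fun_pow 3).fun_mul (h.hasDerivAt_comp_T hp
    E'.smooth_F)).fun_mul ((h.hasDerivAt_U hp).fun_pow 2)).fun_sub (h.hasDerivAt_pdt_X hp)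
  have := hL.unique (hR.congr_of_eventuallyEq ((eventually_line_u h.isOpen hp).mono
    fun z hz => h.coefficient_u_x hz))
  simp at this
  linear_combination this / 2

theorem coefficient_u_x_deriv_deriv (h : AdmissibleComponents E E' Ω T X U) (hp : p ∈ Ω) :
    pdx X p * E.F p.1 = pdx X p ^ 3 * E'.F (T p) * pdu U p ^ 2 := by
  obtain ⟨t, x, w⟩ := p
  have hL := ((h.hasDerivAt_pdx_X hp).mul_const (E.F t)).fun_mul (hasDerivAt_id w)
  have hR := (((h.hasDerivAt_pdx_X hp).fun_pow 3).fun_mul (h.hasDerivAt_comp_T hp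
    E'.smooth_F)).fun_mul ((h.hasDerivAt_U hp).fun_mul (h.hasDerivAt_pdu_U hp))
  have := hL.unique (hR.congr_of_eventuallyEq ((eventually_line_u h.isOpen hp).mono
    fun z hz => h.coefficient_u_x_deriv hz))
  simp at this
  linear_combination this

theorem U_eq (h : AdmissibleComponents E E' Ω T X U) (hp : p ∈ Ω) : U p = p.2.2 * pdu U p := by
  have h1 := h.coefficient_u_x_deriv hp
  have h2 := h.coefficient_u_x_deriv_deriv hp
  have h3 : pdx X p ^ 3 * E'.F (T p) * pdu U p ≠ 0 :=
    mul_ne_zero (mul_ne_zero (pow_ne_zero 3 (h.pdx_X_ne_zero hp))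
      (E'.F_ne_zero _ (h.transforms.1 p hp))) (h.pdu_U_ne_zero hp)
  refine mul_left_cancel₀ h3 ?_
  linear_combination p.2.2 * h2 - h1

theorem pdt_X (h : AdmissibleComponents E E' Ω T X U) : ∀ p ∈ Ω, pdt X p = 0 := by
  intro p hp
  have h1 := h.coefficient_u_x hp
  rw [h.U_eq hp] at h1
  linear_combination h1 - p.2.2 ^ 2 * h.coefficient_u_x_deriv_deriv hp

theorem pdx_U (h : AdmissibleComponents E E' Ω T X U) : ∀ p ∈ Ω, pdx U p = 0 := by
  rintro ⟨t, x, w⟩ hp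
  have h1 := hasDerivAt_line_x (differentiableAt_of_smooth (h.smooth_U _ hp))
  have h2 := (hasDerivAt_line_x (differentiableAt_of_smooth
    (contDiffAt_dirDeriv (e := (0, 0, 1)) (h.smooth_U _ hp)))).const_mul w
  rw [h1.unique (h2.congr_of_eventuallyEq ((eventually_line_x h.isOpen hp).mono
    fun y hy => h.U_eq hy)), h.pdx_pdu_U _ hp, mul_zero]

theorem pdt_U (h : AdmissibleComponents E E' Ω T X U) (hp : p ∈ Ω) :
    pdt U p = p.2.2 * pdt (pdu U) p := by
  obtain ⟨t, x, w⟩ := p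
  have h1 := hasDerivAt_line_t (differentiableAt_of_smooth (h.smooth_U _ hp))
  have h2 := (hasDerivAt_line_t (differentiableAt_of_smooth
    (contDiffAt_dirDeriv (e := (0, 0, 1)) (h.smooth_U _ hp)))).const_mul w
  exact h1.unique (h2.congr_of_eventuallyEq ((eventually_line_t h.isOpen hp).mono
    fun s hs => h.U_eq hs))

theorem free_coefficient (h : AdmissibleComponents E E' Ω T X U) (hp : p ∈ Ω) :
    pdx X p ^ 3 * E'.L (T p) - pdt U p = E.L p.1 * pdu U p := by
  have h0 := h.jet_identity hp 0 0
  have hz : pdx (pdx (pdx U)) p = 0 :=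
    dirDeriv_eq_zero_of_eqOn_zero h.isOpen
      (dirDeriv_eq_zero_of_eqOn_zero h.isOpen h.pdx_U _) _ p hp
  rw [h.total₃_U hp, hz] at h0
  simpa [total₁, h.pdx_U p hp] using h0

theorem pdt_pdu_U (h : AdmissibleComponents E E' Ω T X U) : ∀ p ∈ Ω, pdt (pdu U) p = 0 := by
  rintro ⟨t, x, w⟩ hp
  have h1 := (((h.hasDerivAt_pdx_X hp).fun_pow 3).fun_mul (h.hasDerivAt_comp_T hp
    E'.smooth_L)).fun_sub (hasDerivAt_line_u (differentiableAt_of_smooth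
      (contDiffAt_dirDeriv (e := (1, 0, 0)) (h.smooth_U _ hp))))
  have h2 := (h.hasDerivAt_pdu_U hp).const_mul (E.L t)
  have h3 := h2.unique (h1.congr_of_eventuallyEq ((eventually_line_u h.isOpen hp).mono
    fun z hz => (h.free_coefficient hz).symm))
  refine (dirDeriv_comm (h.smooth_U _ hp) _ _).trans ?_
  simpa using h3.symm

theorem target_F (h : AdmissibleComponents E E' Ω T X U) (hp : p ∈ Ω) :
    E'.F (T p) = E.F p.1 / (pdx X p ^ 2 * pdu U p ^ 2) := by
  have hX := h.pdx_X_ne_zero hp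
  have hU := h.pdu_U_ne_zero hp
  rw [eq_div_iff (by positivity)]
  refine mul_left_cancel₀ hX ?_
  linear_combination -h.coefficient_u_x_deriv_deriv hp

theorem target_L (h : AdmissibleComponents E E' Ω T X U) (hp : p ∈ Ω) :
    E'.L (T p) = pdu U p / pdx X p ^ 3 * E.L p.1 := by
  have hX := h.pdx_X_ne_zero hp
  have := h.free_coefficient hp
  rw [h.pdt_U hp, h.pdt_pdu_U p hp] at this
  field_simp
  linear_combination this

theorem exists_const (h : AdmissibleComponents E E' Ω T X U) {g : ℝ × ℝ × ℝ → ℝ}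
    (hg : ∀ p ∈ Ω, ContDiffAt ℝ ∞ g p) {a b : ℝ} (ht : ∀ p ∈ Ω, pdt g p = a)
    (hx : ∀ p ∈ Ω, pdx g p = b) (hu : ∀ p ∈ Ω, pdu g p = 0) :
    ∃ d, ∀ p ∈ Ω, g p = a * p.1 + b * p.2.1 + d := by
  let l : ℝ × ℝ × ℝ →L[ℝ] ℝ := a • .fst ℝ ℝ (ℝ × ℝ) +
    b • (ContinuousLinearMap.fst ℝ ℝ ℝ).comp (.snd ℝ ℝ (ℝ × ℝ))
  obtain ⟨d, hd⟩ := h.isOpen.exists_eq_add_of_fderiv_eq h.isConnected.isPreconnected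
    (f := g) (g := l) (fun p hp => (differentiableAt_of_smooth (hg p hp)).differentiableWithinAt)
    l.differentiableOn (by
      intro p hp
      refine ContinuousLinearMap.ext fun ⟨r, s, z⟩ => ?_
      rw [fderiv_apply_eq_partials, ht p hp, hx p hp, hu p hp, l.fderiv]
      simp [l])
  exact ⟨d, fun p hp => hd hp⟩

theorem exists_constants (h : AdmissibleComponents E E' Ω T X U) :
    ∃ δ₀ δ₁ δ₂ δ₃ : ℝ, δ₁ * δ₂ ≠ 0 ∧ ∀ p ∈ Ω, (pdx X p = δ₁ ∧ pdu U p = δ₂) ∧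
      T p = δ₁ ^ 3 * p.1 + δ₀ ∧ X p = δ₁ * p.2.1 + δ₃ ∧ U p = δ₂ * p.2.2 := by
  obtain ⟨p₀, hp₀⟩ := h.isConnected.nonempty
  have hXt : ∀ p ∈ Ω, pdt (pdx X) p = 0 := by
    intro p hp
    refine (dirDeriv_comm (h.smooth_X p hp) _ _).trans ?_
    exact dirDeriv_eq_zero_of_eqOn_zero h.isOpen h.pdt_X _ p hp
  obtain ⟨δ₁, hδ₁⟩ := h.exists_const (g := pdx X) (fun p hp => contDiffAt_dirDeriv (h.smooth_X p hp))
    hXt h.pdx_pdx_X h.pdu_pdx_X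
  obtain ⟨δ₂, hδ₂⟩ := h.exists_const (g := pdu U) (fun p hp => contDiffAt_dirDeriv (h.smooth_U p hp))
    h.pdt_pdu_U h.pdx_pdu_U h.pdu_pdu_U
  simp only [zero_mul, zero_add] at hδ₁ hδ₂
  obtain ⟨δ₃, hδ₃⟩ := h.exists_const h.smooth_X h.pdt_X hδ₁ h.pdu_X
  obtain ⟨δ₀, hδ₀⟩ := h.exists_const (a := δ₁ ^ 3) h.smooth_T
    (fun p hp => by rw [h.pdt_T hp, hδ₁ p hp]) h.pdx_T h.pdu_T
  have n₁ : δ₁ ≠ 0 := hδ₁ p₀ hp₀ ▸ h.pdx_X_ne_zero hp₀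
  have n₂ : δ₂ ≠ 0 := hδ₂ p₀ hp₀ ▸ h.pdu_U_ne_zero hp₀
  refine ⟨δ₀, δ₁, δ₂, δ₃, mul_ne_zero n₁ n₂, fun p hp => ⟨⟨hδ₁ p hp, hδ₂ p hp⟩, ?_, ?_, ?_⟩⟩
  · rw [hδ₀ p hp]
    ring
  · rw [hδ₃ p hp]
    ring
  · rw [h.U_eq hp, hδ₂ p hp, mul_comm]

end AdmissibleComponents


theorem det_fderiv_ne_zero_of_leftInverse {V : Type*} [NormedAddCommGroup V] [NormedSpace ℝ V]
    {f g : V → V} (hgf : Function.LeftInverse g f) {p : V} (hf : DifferentiableAt ℝ f p)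
    (hg : DifferentiableAt ℝ g (f p)) : (fderiv ℝ f p).det ≠ 0 := by
  have h1 : (fderiv ℝ g (f p)).comp (fderiv ℝ f p) = .id ℝ V := by
    rw [← fderiv_comp p hg hf, hgf.comp_eq_id, fderiv_id]
  have h2 : LinearMap.det ((fderiv ℝ g (f p) : V →ₗ[ℝ] V) ∘ₗ (fderiv ℝ f p : V →ₗ[ℝ] V)) = 1 := by
    rw [← ContinuousLinearMap.toLinearMap_comp, h1]
    exact LinearMap.det_id
  rw [LinearMap.det_comp] at h2
  exact right_ne_zero_of_mul (h2 ▸ one_ne_zero)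

/-- The scalings and shifts of the variables that form the equivalence group. -/
noncomputable def scaling (δ₀ δ₁ δ₂ δ₃ : ℝ) (p : ℝ × ℝ × ℝ) : ℝ × ℝ × ℝ :=
  (δ₁ ^ 3 * p.1 + δ₀, δ₁ * p.2.1 + δ₃, δ₂ * p.2.2)

/-- The scalings of the arbitrary elements that correspond to `scaling`. -/
noncomputable def eltsScaling (δ₁ δ₂ : ℝ) (a : ℝ × ℝ) : ℝ × ℝ :=
  (a.1 / (δ₁ ^ 2 * δ₂ ^ 2), δ₂ / δ₁ ^ 3 * a.2)

/-- The inverse of `scaling`. -/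
noncomputable def unscaling (δ₀ δ₁ δ₂ δ₃ : ℝ) (p : ℝ × ℝ × ℝ) : ℝ × ℝ × ℝ :=
  ((p.1 - δ₀) / δ₁ ^ 3, (p.2.1 - δ₃) / δ₁, p.2.2 / δ₂)

section Scaling

variable {δ₀ δ₁ δ₂ δ₃ : ℝ}

theorem contDiff_scaling : ContDiff ℝ ∞ (scaling δ₀ δ₁ δ₂ δ₃) := by
  unfold scaling
  fun_prop

theorem contDiff_unscaling : ContDiff ℝ ∞ (unscaling δ₀ δ₁ δ₂ δ₃) := by
  unfold unscaling
  fun_prop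

theorem contDiff_eltsScaling : ContDiff ℝ ∞ (eltsScaling δ₁ δ₂) := by
  unfold eltsScaling
  fun_prop

theorem unscaling_scaling (h₁ : δ₁ ≠ 0) (h₂ : δ₂ ≠ 0) :
    Function.LeftInverse (unscaling δ₀ δ₁ δ₂ δ₃) (scaling δ₀ δ₁ δ₂ δ₃) := by
  rintro ⟨t, x, u⟩
  simp [scaling, unscaling, h₁, h₂]

theorem eltsScaling_leftInverse (h₁ : δ₁ ≠ 0) (h₂ : δ₂ ≠ 0) :
    Function.LeftInverse (eltsScaling δ₁⁻¹ δ₂⁻¹) (eltsScaling δ₁ δ₂) := by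
  rintro ⟨a, b⟩
  simp only [eltsScaling, Prod.mk.injEq]
  constructor <;> field_simp

theorem det_scaling_ne_zero (h₁ : δ₁ ≠ 0) (h₂ : δ₂ ≠ 0) (p : ℝ × ℝ × ℝ) :
    (fderiv ℝ (scaling δ₀ δ₁ δ₂ δ₃) p).det ≠ 0 :=
  det_fderiv_ne_zero_of_leftInverse (unscaling_scaling h₁ h₂)
    (differentiableAt_of_smooth contDiff_scaling.contDiffAt)
    (differentiableAt_of_smooth contDiff_unscaling.contDiffAt)

theorem contDiff_prodMap_scaling :
    ContDiff ℝ ∞ (Prod.map (scaling δ₀ δ₁ δ₂ δ₃) (eltsScaling δ₁ δ₂)) :=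
  contDiff_scaling.prodMap contDiff_eltsScaling

theorem det_prodMap_scaling_ne_zero (h₁ : δ₁ ≠ 0) (h₂ : δ₂ ≠ 0) (z : (ℝ × ℝ × ℝ) × (ℝ × ℝ)) :
    (fderiv ℝ (Prod.map (scaling δ₀ δ₁ δ₂ δ₃) (eltsScaling δ₁ δ₂)) z).det ≠ 0 :=
  det_fderiv_ne_zero_of_leftInverse
    (g := Prod.map (unscaling δ₀ δ₁ δ₂ δ₃) (eltsScaling δ₁⁻¹ δ₂⁻¹))
    ((unscaling_scaling h₁ h₂).prodMap (eltsScaling_leftInverse h₁ h₂))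
    (differentiableAt_of_smooth contDiff_prodMap_scaling.contDiffAt)
    (differentiableAt_of_smooth
      (contDiff_unscaling.prodMap contDiff_eltsScaling).contDiffAt)

theorem deriv_mul_comp_affine (k a b : ℝ) (g : ℝ → ℝ) :
    deriv (fun y => k * g (a * y + b)) = fun y => k * a * deriv g (a * y + b) := by
  ext y
  have h := deriv_comp_mul_left a (fun z => g (z + b)) y
  rw [deriv_comp_add_const] at h
  rw [deriv_const_mul_field, h, smul_eq_mul, mul_assoc]

/-- The image of the equation `E` under the scaling. -/
noncomputable def Equation.scale (E : Equation) (δ₀ δ₁ δ₂ : ℝ) (h₁ : δ₁ ≠ 0) (h₂ : δ₂ ≠ 0) :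
    Equation where
  interval := (fun s => (s - δ₀) / δ₁ ^ 3) ⁻¹' E.interval
  isOpen_interval := E.isOpen_interval.preimage (by fun_prop)
  isConnected_interval := by
    have h3 : δ₁ ^ 3 ≠ 0 := pow_ne_zero 3 h₁
    rw [← Set.image_eq_preimage_of_inverse (f := fun t => δ₁ ^ 3 * t + δ₀)]
    · exact E.isConnected_interval.image _ (by fun_prop)
    · intro t
      simp [h₁]
    · intro s
      simp only
      field_simp
      ring
  F s := E.F ((s - δ₀) / δ₁ ^ 3) / (δ₁ ^ 2 * δ₂ ^ 2)
  L s := δ₂ / δ₁ ^ 3 * E.L ((s - δ₀) / δ₁ ^ 3)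
  smooth_F := (E.smooth_F.comp (f := fun s => (s - δ₀) / δ₁ ^ 3)
    (ContDiff.contDiffOn (by fun_prop)) (fun _ h => h)).div_const _
  smooth_L := contDiffOn_const.mul (E.smooth_L.comp (f := fun s => (s - δ₀) / δ₁ ^ 3)
    (ContDiff.contDiffOn (by fun_prop)) (fun _ h => h))
  F_ne_zero s hs := div_ne_zero (E.F_ne_zero _ hs)
    (mul_ne_zero (pow_ne_zero 2 h₁) (pow_ne_zero 2 h₂))

theorem transforms_scale (E : Equation) (h₁ : δ₁ ≠ 0) (h₂ : δ₂ ≠ 0)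
    {φ : ℝ × ℝ × ℝ → ℝ × ℝ × ℝ} {Ω : Set (ℝ × ℝ × ℝ)} (hΩ : IsOpen Ω)
    (hφ : Set.EqOn φ (scaling δ₀ δ₁ δ₂ δ₃) Ω) :
    Transforms φ {p ∈ Ω | p.1 ∈ E.interval} E (E.scale δ₀ δ₁ δ₂ h₁ h₂) := by
  have hback : ∀ t, (δ₁ ^ 3 * t + δ₀ - δ₀) / δ₁ ^ 3 = t := fun t => by simp [h₁]
  constructor
  · rintro p ⟨hp, hpt⟩
    rw [hφ hp]
    change (δ₁ ^ 3 * p.1 + δ₀ - δ₀) / δ₁ ^ 3 ∈ E.interval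
    rwa [hback]
  · rintro u v t x t' x' u' ⟨hp, -⟩ himg hu hv hg
    rw [hφ hp] at himg
    obtain ⟨rfl, rfl, rfl⟩ : δ₁ ^ 3 * t + δ₀ = t' ∧ δ₁ * x + δ₃ = x' ∧ δ₂ * u (t, x) = u' := by
      simpa [scaling] using himg
    have hc : ContinuousAt (fun q : ℝ × ℝ => (q.1, q.2, u q)) (t, x) :=
      continuousAt_fst.prodMk (continuousAt_snd.prodMk hu.continuousAt)
    have huv : ∀ᶠ q in 𝓝 (t, x), u q = δ₂⁻¹ * v (δ₁ ^ 3 * q.1 + δ₀, δ₁ * q.2 + δ₃) := by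
      filter_upwards [hg, hc.eventually_mem (hΩ.mem_nhds hp)] with q h1 h2
      rw [hφ h2] at h1
      simp only [scaling] at h1
      rw [h1, inv_mul_cancel_left₀ h₂]
    obtain ⟨f, hf⟩ : ∃ f : ℝ → ℝ, f = fun z => v (δ₁ ^ 3 * t + δ₀, z) := ⟨_, rfl⟩
    obtain ⟨g, hg⟩ : ∃ g : ℝ → ℝ, g = fun z => v (z, δ₁ * x + δ₃) := ⟨_, rfl⟩
    have hx : (fun y => u (t, y)) =ᶠ[𝓝 x] fun y => δ₂⁻¹ * f (δ₁ * y + δ₃) := by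
      have hline : ContinuousAt (fun y => (t, y)) x := by fun_prop
      filter_upwards [hline.tendsto.eventually huv] with y hy
      rw [hy, hf]
    have ht : (fun s => u (s, x)) =ᶠ[𝓝 t] fun s => δ₂⁻¹ * g (δ₁ ^ 3 * s + δ₀) := by
      have hline : ContinuousAt (fun s => (s, x)) t := by fun_prop
      filter_upwards [hline.tendsto.eventually huv] with s hs
      rw [hs, hg]
    rw [Equation.HoldsAt, Equation.HoldsAt, iteratedDeriv_three, iteratedDeriv_three,
      hx.deriv.deriv.deriv_eq, hx.deriv_eq, ht.deriv_eq, huv.self_of_nhds, ← hf, ← hg]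
    simp only [deriv_mul_comp_affine, Equation.scale, hback]
    field_simp

end Scaling

theorem ExtendedTransformation.isUsualEquivalence_of_eqOn (T : ExtendedTransformation)
    {δ₀ δ₁ δ₂ δ₃ : ℝ} (h₁ : δ₁ ≠ 0) (h₂ : δ₂ ≠ 0)
    (hvars : Set.EqOn T.vars (scaling δ₀ δ₁ δ₂ δ₃) T.domain)
    (helts : ∀ p ∈ T.domain, Set.EqOn (T.elts p) (eltsScaling δ₁ δ₂) arbitraryValues) :
    T.IsUsualEquivalence := by
  have hopen : IsOpen (T.domain ×ˢ arbitraryValues) :=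
    T.isOpen_domain.prod (isOpen_ne_fun continuous_fst continuous_const)
  have hmap : Set.EqOn T.toMap (Prod.map (scaling δ₀ δ₁ δ₂ δ₃) (eltsScaling δ₁ δ₂))
      (T.domain ×ˢ arbitraryValues) :=
    fun z hz => Prod.ext (hvars hz.1) (helts _ hz.1 hz.2)
  refine ⟨⟨T.isOpen_domain, T.isConnected_domain, contDiff_scaling.contDiffOn.congr hvars, ?_⟩,
    contDiff_prodMap_scaling.contDiffOn.congr hmap, ?_, ?_⟩
  · intro p hp
    rw [(hvars.eventuallyEq_of_mem (T.isOpen_domain.mem_nhds hp)).fderiv_eq]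
    exact det_scaling_ne_zero h₁ h₂ p
  · intro z hz
    rw [(hmap.eventuallyEq_of_mem (hopen.mem_nhds hz)).fderiv_eq]
    exact det_prodMap_scaling_ne_zero h₁ h₂ z
  · intro E
    refine ⟨E.scale δ₀ δ₁ δ₂ h₁ h₂, transforms_scale E h₁ h₂ T.isOpen_domain hvars, ?_⟩
    rintro p ⟨hp, hpt⟩
    rw [hvars hp, helts p hp (E.F_ne_zero _ hpt)]
    simp [scaling, eltsScaling, Equation.scale, h₁]

theorem isNormalizedInUsualSense : IsNormalizedInUsualSense := by
  intro E E' φ Ω hadm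
  have h := hadm.components
  obtain ⟨δ₀, δ₁, δ₂, δ₃, hδ, hform⟩ := h.exists_constants
  refine ⟨⟨Ω, scaling δ₀ δ₁ δ₂ δ₃, fun _ => eltsScaling δ₁ δ₂, h.isOpen, h.isConnected⟩,
    ExtendedTransformation.isUsualEquivalence_of_eqOn _ (left_ne_zero_of_mul hδ)
      (right_ne_zero_of_mul hδ) (fun _ _ => rfl) (fun _ _ _ _ => rfl), subset_rfl, ?_, ?_⟩
  · intro p hp
    obtain ⟨-, hT, hX, hU⟩ := hform p hp
    exact Prod.ext hT (Prod.ext hX hU)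
  · intro p hp
    obtain ⟨⟨hx, hu⟩, hT, -, -⟩ := hform p hp
    have hF := h.target_F hp
    have hL := h.target_L hp
    rw [hT, hx, hu] at hF hL
    exact Prod.ext hF hL

/-- The equation of the class with constant coefficients `F` and `L`. -/
def Equation.const (F L : ℝ) (hF : F ≠ 0) : Equation where
  interval := Set.univ
  isOpen_interval := isOpen_univ
  isConnected_interval := isConnected_univ
  F _ := F
  L _ := L
  smooth_F := contDiffOn_const
  smooth_L := contDiffOn_const
  F_ne_zero _ _ := hF

theorem ExtendedTransformation.IsUsualEquivalence.exists_components_const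
    {T : ExtendedTransformation} (hT : T.IsUsualEquivalence) {F : ℝ} (L : ℝ) (hF : F ≠ 0) :
    ∃ E' : Equation, AdmissibleComponents (Equation.const F L hF) E' T.domain
        (fun p => (T.vars p).1) (fun p => (T.vars p).2.1) (fun p => (T.vars p).2.2) ∧
      ∀ p ∈ T.domain, T.elts p (F, L) = (E'.F (T.vars p).1, E'.L (T.vars p).1) := by
  obtain ⟨E', htr, hel⟩ := hT.maps_class (Equation.const F L hF)
  have hd : {p ∈ T.domain | p.1 ∈ (Equation.const F L hF).interval} = T.domain := by
    simp [Equation.const]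
  rw [hd] at htr hel
  exact ⟨E', IsAdmissible.components ⟨hT.pointTransformation, fun _ _ => trivial, htr⟩,
    fun p hp => (hel p hp).symm⟩

theorem ExtendedTransformation.IsUsualEquivalence.exists_constants
    {T : ExtendedTransformation} (hT : T.IsUsualEquivalence) :
    ∃ δ₀ δ₁ δ₂ δ₃ : ℝ, δ₁ * δ₂ ≠ 0 ∧ ∀ p ∈ T.domain, T.vars p = scaling δ₀ δ₁ δ₂ δ₃ p ∧
      ∀ a ∈ arbitraryValues, T.elts p a = eltsScaling δ₁ δ₂ a := by
  obtain ⟨_, h, -⟩ := hT.exists_components_const 0 one_ne_zero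
  obtain ⟨δ₀, δ₁, δ₂, δ₃, hδ, hform⟩ := h.exists_constants
  refine ⟨δ₀, δ₁, δ₂, δ₃, hδ, fun p hp => ?_⟩
  obtain ⟨⟨hx, hu⟩, h1, h2, h3⟩ := hform p hp
  refine ⟨Prod.ext h1 (Prod.ext h2 h3), ?_⟩
  rintro ⟨F, L⟩ hF
  obtain ⟨E', h', hel⟩ := hT.exists_components_const L (show F ≠ 0 from hF)
  rw [hel p hp, h'.target_F hp, h'.target_L hp, hx, hu]
  rfl

end ForcedMKdV

theorem theorem4 :
    ForcedMKdV.IsNormalizedInUsualSense ∧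
    ∀ T : ForcedMKdV.ExtendedTransformation,
      T ∈ ForcedMKdV.usualEquivalenceGroup ↔
        ∃ δ₀ δ₁ δ₂ δ₃ : ℝ, δ₁ * δ₂ ≠ 0 ∧
          ∀ t x u : ℝ, (t, x, u) ∈ T.domain →
            T.vars (t, x, u) = (δ₁ ^ 3 * t + δ₀, δ₁ * x + δ₃, δ₂ * u) ∧
            ∀ F L : ℝ, F ≠ 0 →
              T.elts (t, x, u) (F, L) = (F / (δ₁ ^ 2 * δ₂ ^ 2), δ₂ / δ₁ ^ 3 * L) := by
  refine ⟨ForcedMKdV.isNormalizedInUsualSense, fun T => ⟨fun hT => ?_, ?_⟩⟩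
  · obtain ⟨δ₀, δ₁, δ₂, δ₃, hδ, h⟩ :=
      ForcedMKdV.ExtendedTransformation.IsUsualEquivalence.exists_constants hT
    exact ⟨δ₀, δ₁, δ₂, δ₃, hδ, fun t x u hp => ⟨(h _ hp).1, fun F L hF => (h _ hp).2 (F, L) hF⟩⟩
  · rintro ⟨δ₀, δ₁, δ₂, δ₃, hδ, h⟩
    exact T.isUsualEquivalence_of_eqOn (left_ne_zero_of_mul hδ) (right_ne_zero_of_mul hδ)
      (fun p hp => (h p.1 p.2.1 p.2.2 hp).1) (fun p hp a ha => (h p.1 p.2.1 p.2.2 hp).2 a.1 a.2 ha)
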